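/- Let $X$ be a noetherian scheme and let $Z \subseteq X$ be a closed subscheme. Let $\mathbf{D}(X)$ be the full subcategory of the derived category of sheaves of $\mathcal{O}_X$-modules consisting of the complexes with quasi-coherent cohomology, let $\mathbf{D}^b(X) \subseteq \mathbf{D}(X)$ be the full subcategory of bounded complexes with coherent cohomology, let $\mathbf{D}_Z(X) \subseteq \mathbf{D}(X)$ be the full subcategory of complexes whose cohomology sheaves are supported on $Z$, and put $\mathbf{D}^b_Z(X) := \mathbf{D}_Z(X) \cap \mathbf{D}^b(X)$. Then for every object $\mathcal{E}$ of $\mathbf{D}^b_Z(X)$ the endomorphism ring $R := \operatorname{End}_{\mathbf{D}^b_Z(X)}(\mathcal{E})$ (with multiplication $fg = f \circ g$) is (right) idempotent noetherian, that is: for every sequence $(a_i)_{i \in \mathbb{N}}$ of elements of $R$ such that $a_j a_i = a_i$ for all $i < j$, there exists a positive integer $n$ such that $a_i R = a_n R$ for all $i \geq n$. -/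

import Mathlib

open CategoryTheory CategoryTheory.Limits AlgebraicGeometry

universe w u

/-- A ring `R` is (right) idempotent noetherian if for every sequence `a` in `R` with
`a j * a i = a i` for all `i < j`, the right ideals `a i R` are eventually constant:
there is a positive integer `n` with `a i R = a n R` for all `i ≥ n`. -/
def IsIdempotentNoetherian (R : Type*) [Ring R] : Prop :=
  ∀ a : ℕ → R, (∀ i j : ℕ, i < j → a j * a i = a i) →
    ∃ n : ℕ, 0 < n ∧ ∀ i : ℕ, n ≤ i →
      Set.range (fun r : R => a i * r) = Set.range (fun r : R => a n * r)

namespace AlgebraicGeometry.Scheme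

/-- The support of a sheaf of modules: the set of points at which the stalk is nonzero. -/
def Modules.support {X : Scheme.{u}} (M : X.Modules) : Set X :=
  {x | ¬ IsZero (M.presheaf.stalk x)}

/-- Coherent sheaves on a (locally) noetherian scheme: the quasi-coherent sheaves `M` such that
`X` is covered by affine open subschemes `U` for which `Γ(M, U)` is a finitely generated
`Γ(X, U)`-module, i.e. `M` is locally the sheaf associated with a finitely generated module. -/
structure Modules.IsCoherent {X : Scheme.{u}} (M : X.Modules) : Prop where
  isQuasicoherent : SheafOfModules.IsQuasicoherent (R := X.ringCatSheaf) M
  exists_affine_finite : ∀ x : X, ∃ U : X.Opens, IsAffineOpen U ∧ x ∈ U ∧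
    Module.Finite Γ(X, U) Γ(M, U)

/-- The property which defines `D(X)` as a full subcategory of the derived category of
`𝒪_X`-modules: all cohomology sheaves are quasi-coherent. -/
def dQcoh (X : Scheme.{u}) [HasDerivedCategory.{w} X.Modules] :
    ObjectProperty (DerivedCategory X.Modules) := fun E =>
  ∀ k : ℤ, SheafOfModules.IsQuasicoherent (R := X.ringCatSheaf)
    ((DerivedCategory.homologyFunctor X.Modules k).obj E)

/-- The property which defines `D^b(X)` as a full subcategory of `D(X)`: the object is bounded
(for the canonical t-structure, i.e. only finitely many cohomology sheaves are nonzero) and its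
cohomology sheaves are coherent. -/
def dBounded (X : Scheme.{u}) [HasDerivedCategory.{w} X.Modules] :
    ObjectProperty (DerivedCategory X.Modules) := fun E =>
  X.dQcoh E ∧ DerivedCategory.TStructure.t.bounded E ∧
    ∀ k : ℤ, Modules.IsCoherent ((DerivedCategory.homologyFunctor X.Modules k).obj E)

/-- The property which defines `D_Z(X)` as a full subcategory of `D(X)`: all cohomology sheaves
are supported on the subset `Z`. -/
def dSupported (X : Scheme.{u}) [HasDerivedCategory.{w} X.Modules] (Z : Set X) :
    ObjectProperty (DerivedCategory X.Modules) := fun E =>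
  X.dQcoh E ∧
    ∀ k : ℤ, Modules.support ((DerivedCategory.homologyFunctor X.Modules k).obj E) ⊆ Z

/-- The category `D^b_Z(X) = D_Z(X) ∩ D^b(X)`, for a closed subscheme `i : Z ⟶ X`. -/
abbrev DbSupported {X Z : Scheme.{u}} (i : Z ⟶ X) [IsClosedImmersion i]
    [HasDerivedCategory.{w} X.Modules] : Type (u + 1) :=
  (X.dSupported (Set.range i) ⊓ X.dBounded).FullSubcategory

end AlgebraicGeometry.Scheme

universe v

/-! `End E` acts on the finitely many nonzero cohomology sheaves of `E`. On a coherent sheaf the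
images of the `a i` increase and so stabilise, whence `a i * a j = a j` on cohomology for all large
`i`, `j` (`IsCoherent.exists_comp_eq`). The endomorphisms that vanish on cohomology form a nilpotent
ideal, because each one composed lowers the truncation by a degree (`comp_truncGEπ_eq_zero`).
`exists_of_nilpotent` lifts the stabilisation through this ideal. -/

/-- A filtration `F` whose steps absorb left multiplication by `N`, starting from the whole ring
and ending at zero, expresses that `N` is nilpotent. -/
lemma IsIdempotentNoetherian.exists_of_nilpotent {R : Type*} [Ring R] (N : Set R) (F : ℕ → Set R)
    (zero_mem : ∀ p, p ∈ F 0) (mul_mem : ∀ r u p, u ∈ N → p ∈ F r → u * p ∈ F (r + 1))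
    (m : ℕ) (eq_zero : ∀ p ∈ F m, p = 0) (a : ℕ → R) (ha : ∀ i j : ℕ, i < j → a j * a i = a i)
    (n : ℕ) (hn : ∀ i j : ℕ, n < i → n < j → a j - a i * a j ∈ N) :
    ∃ n : ℕ, 0 < n ∧ ∀ i : ℕ, n ≤ i →
      Set.range (fun r : R => a i * r) = Set.range (fun r : R => a n * r) := by
  refine ⟨n + 1, by lia, fun j hj ↦ ?_⟩
  obtain rfl | hj := hj.eq_or_lt
  · rfl
  let b := a (n + 1)
  let u (l : ℕ) := a l - b * a l
  -- `a (l + 1)` fixes `u l` and equals `b * a (l + 1) + u (l + 1)`. Iterating writes `a j` modulo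
  -- `b R` as ever longer products from `N`.
  have hu (l : ℕ) (hl : n < l) : u l = b * (a (l + 1) * u l) + u (l + 1) * u l := by
    have : u l = a (l + 1) * u l := by
      simp only [u, b, mul_sub, ← mul_assoc, ha _ _ (show l < l + 1 by lia),
        ha _ _ (show n + 1 < l + 1 by lia)]
    conv_lhs => rw [this]
    simp only [u]
    noncomm_ring
  have key (r : ℕ) : ∃ x, ∃ p ∈ F r, a j = b * x + u (j + r) * p := by
    induction r with
    | zero => exact ⟨a j, 1, zero_mem _, by simp [u]⟩
    | succ r ih =>
      obtain ⟨x, p, hp, e⟩ := ih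
      refine ⟨x + a (j + r + 1) * u (j + r) * p, u (j + r) * p,
        mul_mem _ _ _ (hn _ _ (by lia) (by lia)) hp, ?_⟩
      rw [hu _ (by lia)] at e
      rw [e, ← add_assoc j r 1]
      noncomm_ring
  obtain ⟨x, p, hp, e⟩ := key m
  rw [eq_zero p hp, mul_zero, add_zero] at e
  apply Set.Subset.antisymm
  · rintro _ ⟨r, rfl⟩
    exact ⟨x * r, by simp only [e, b, mul_assoc]⟩
  · rintro _ ⟨r, rfl⟩
    exact ⟨a (n + 1) * r, by simp only [← mul_assoc, ha _ _ hj]⟩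

namespace DerivedCategory

variable {C : Type u} [Category.{v} C] [Abelian C] [HasDerivedCategory.{w} C]

open Pretriangulated Triangulated TStructure

/-- Under these bounds a morphism is determined by its effect on `H^n`. Here the truncation `τ≤n` of
the fibre of `φ` maps isomorphically to `A`, so the fibre inclusion has a section. -/
lemma eq_zero_of_homologyFunctor_map_eq_zero {A T : DerivedCategory C} (φ : A ⟶ T) (n : ℤ)
    [A.IsLE n] [T.IsGE n] (h : (homologyFunctor C n).map φ = 0) : φ = 0 := by
  obtain ⟨K, f, g, hT⟩ := distinguished_cocone_triangle₁ φ
  let T₁ := Triangle.mk f φ g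
  obtain ⟨L, M, hL, hM, i, q, d, hT₂⟩ := t.exists_triangle K n (n + 1) rfl
  let T₂ := Triangle.mk i q d
  have hLE : L.IsLE n := ⟨hL⟩
  have hGE : M.IsGE (n + 1) := ⟨hM⟩
  have : IsIso (i ≫ f) := by
    rw [isIso_iff]
    intro k
    by_cases hk : k ≤ n
    · have h₁ : IsIso ((homologyFunctor C k).map i) := by
        have := (HomologySequence.epi_homologyMap_mor₁_iff T₂ hT₂ k).mpr
          ((M.isZero_of_isGE (n + 1) k (by lia)).eq_of_tgt _ _)
        have := (HomologySequence.mono_homologyMap_mor₁_iff T₂ hT₂ (k - 1) k).mpr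
          ((M.isZero_of_isGE (n + 1) (k - 1) (by lia)).eq_of_src _ _)
        exact isIso_of_mono_of_epi ((homologyFunctor C k).map T₂.mor₁)
      have h₂ : IsIso ((homologyFunctor C k).map f) := by
        -- Only degree `n` uses `h`; below it `T` has no cohomology.
        have := (HomologySequence.epi_homologyMap_mor₁_iff T₁ hT k).mpr <| by
          obtain rfl | hk := hk.eq_or_lt
          · exact h
          · exact (T.isZero_of_isGE n k hk).eq_of_tgt _ _
        have := (HomologySequence.mono_homologyMap_mor₁_iff T₁ hT (k - 1) k).mpr
          ((T.isZero_of_isGE n (k - 1) (by lia)).eq_of_src _ _)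
        exact isIso_of_mono_of_epi ((homologyFunctor C k).map T₁.mor₁)
      rw [Functor.map_comp]
      infer_instance
    · exact (L.isZero_of_isLE n k (by lia)).isIso (A.isZero_of_isLE n k (by lia)) _
  rw [← cancel_epi (i ≫ f), comp_zero, Category.assoc,
    show f ≫ φ = 0 from comp_distTriang_mor_zero₁₂ T₁ hT, comp_zero]

/-- The first hypothesis factors `p` through `τ≤n K`; on this piece `u` followed by `K ⟶ τ≥n K` is
zero on `H^n`, hence zero. -/
lemma comp_truncGEπ_eq_zero {K : DerivedCategory C} (n : ℤ) (p u : K ⟶ K)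
    (hp : p ≫ (t.truncGEπ (n + 1)).app K = 0) (hu : (homologyFunctor C n).map u = 0) :
    (p ≫ u) ≫ (t.truncGEπ n).app K = 0 := by
  obtain ⟨(h : K ⟶ (t.truncLT (n + 1)).obj K), (rfl : p = h ≫ (t.truncLTι (n + 1)).app K)⟩ :=
    Triangle.coyoneda_exact₂ _ (t.triangleLTGE_distinguished (n + 1) K) p hp
  have : ((t.truncLT (n + 1)).obj K).IsLE n := t.isLE_truncLT_obj K (n + 1) n
  have : ((t.truncGE n).obj K).IsGE n := t.isGE_truncGE_obj K n n
  have := eq_zero_of_homologyFunctor_map_eq_zero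
    ((t.truncLTι (n + 1)).app K ≫ u ≫ (t.truncGEπ n).app K) n (by simp [hu])
  rw [Category.assoc, Category.assoc]
  exact (congrArg (h ≫ ·) this).trans comp_zero

end DerivedCategory

namespace AlgebraicGeometry.Scheme.Modules

/-- Only the source has to be generated by its global sections, so `N` is arbitrary. -/
lemma hom_eq_zero_of_app_top_eq_zero {R : CommRingCat.{u}} {M N : (Spec R).Modules}
    [M.IsQuasicoherent] (f : M ⟶ N) (h : f.app ⊤ = 0) : f = 0 := by
  have e : (moduleSpecΓFunctor (R := R)).map f = 0 := by
    ext x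
    exact congr($h x)
  have := (fromTildeΓNatTrans (R := R)).naturality f
  have h' : (tilde.functor R).map ((moduleSpecΓFunctor (R := R)).map f) = 0 := by
    rw [e, Functor.map_zero]
  have h₂ : M.fromTildeΓ ≫ f = 0 := by
    refine this.symm.trans ?_
    dsimp only [Functor.comp_map]
    rw [h', zero_comp]
    rfl
  rwa [← cancel_epi M.fromTildeΓ, comp_zero]

variable {X : Scheme.{u}} {M N : X.Modules}

lemma app_eq_zero_of_isAffineOpen [M.IsQuasicoherent] (f : M ⟶ N) {U V : X.Opens}
    (hU : IsAffineOpen U) (h : f.app U = 0) (hV : V ≤ U) : f.app V = 0 := by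
  have key : (restrictFunctor hU.fromSpec).map f = 0 := by
    refine hom_eq_zero_of_app_top_eq_zero _ ?_
    change f.app (hU.fromSpec ''ᵁ ⊤) = 0
    have : hU.fromSpec ''ᵁ ⊤ = U := by simp
    rw [this, h]
  have e : hU.fromSpec ''ᵁ (hU.fromSpec ⁻¹ᵁ V) = V := by
    rw [Scheme.Hom.image_preimage_eq_opensRange_inf]
    simpa using hV
  have : f.app (hU.fromSpec ''ᵁ (hU.fromSpec ⁻¹ᵁ V)) = 0 := congr(($key).app (hU.fromSpec ⁻¹ᵁ V))
  rwa [e] at this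

lemma hom_eq_zero_of_affine_cover [M.IsQuasicoherent] (f : M ⟶ N) {ι : Type*} (U : ι → X.Opens)
    (hU : ∀ i, IsAffineOpen (U i)) (hc : ∀ x : X, ∃ i, x ∈ U i) (h : ∀ i, f.app (U i) = 0) :
    f = 0 := by
  ext V x
  refine TopCat.Presheaf.IsSheaf.section_ext N.isSheaf fun y hy ↦ ?_
  obtain ⟨i, hi⟩ := hc y
  refine ⟨V ⊓ U i, inf_le_left, ⟨hy, hi⟩, ?_⟩
  have h₁ := app_eq_zero_of_isAffineOpen f (hU i) (h i) (V := V ⊓ U i) inf_le_right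
  have h₂ := congr($(f.mapPresheaf.naturality (homOfLE (inf_le_left : V ⊓ U i ≤ V)).op) x)
  simp only [mapPresheaf_app, h₁, comp_zero] at h₂
  simpa using h₂.symm

lemma IsCoherent.exists_comp_eq [IsNoetherian X] (hM : M.IsCoherent) (b : ℕ → (M ⟶ M))
    (hb : ∀ i j, i < j → b i ≫ b j = b i) :
    ∃ n, ∀ i j, n < i → n < j → b j ≫ b i = b j := by
  have := hM.isQuasicoherent
  choose U hU hxU hfin using hM.exists_affine_finite
  have hloc (x : X) : ∃ n, ∀ i j, n < i → n < j → (b j).app (U x) ≫ (b i).app (U x) =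
      (b j).app (U x) := by
    have : IsNoetherianRing Γ(X, U x) := IsLocallyNoetherian.component_noetherian ⟨U x, hU x⟩
    have := hfin x
    let β (i : ℕ) : Γ(M, U x) →ₗ[Γ(X, U x)] Γ(M, U x) :=
      { toFun := (b i).app (U x)
        map_add' := map_add _
        map_smul' r y := Hom.app_smul _ r y }
    have hβ (i j : ℕ) (hij : i < j) (y : Γ(M, U x)) : β j (β i y) = β i y :=
      congr((($(hb i j hij)).app (U x)) y)
    let S : ℕ →o Submodule Γ(X, U x) Γ(M, U x) :=
      { toFun i := LinearMap.range (β i)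
        monotone' := monotone_nat_of_le_succ (by
          rintro i _ ⟨y, rfl⟩
          exact ⟨β i y, hβ i (i + 1) (by lia) y⟩) }
    obtain ⟨n, hn⟩ := monotone_stabilizes_iff_noetherian.mpr inferInstance S
    refine ⟨n, fun i j hi hj ↦ ?_⟩
    ext y
    -- The image of `β j` is that of `β n`, which `β i` fixes since `n < i`.
    have : β j y ∈ S n := by rw [hn j hj.le]; exact ⟨y, rfl⟩
    obtain ⟨z, hz⟩ := this
    change β i (β j y) = β j y
    rw [← hz, hβ _ _ hi]
  choose n hn using hloc
  obtain ⟨s, hs⟩ := CompactSpace.elim_nhds_subcover (fun x ↦ (U x : Set X))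
    fun x ↦ (U x).isOpen.mem_nhds (hxU x)
  refine ⟨s.sup n, fun i j hi hj ↦ ?_⟩
  rw [← sub_eq_zero]
  refine hom_eq_zero_of_affine_cover _ (fun x : s ↦ U x) (fun x ↦ hU x) (fun x ↦ ?_) fun x ↦ ?_
  · have : x ∈ (⊤ : Set X) := trivial
    rw [← hs] at this
    simpa using this
  · have : n x ≤ s.sup n := Finset.le_sup x.2
    rw [Hom.sub_app, Hom.comp_app, hn x i j (by lia) (by lia), sub_self]

end AlgebraicGeometry.Scheme.Modules

open DerivedCategory Triangulated TStructure in
theorem proposition4p3 (X : Scheme.{u}) [IsNoetherian X] [HasDerivedCategory.{w} X.Modules]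
    (Z : Scheme.{u}) (i : Z ⟶ X) [IsClosedImmersion i] (E : Scheme.DbSupported.{w} i) :
    IsIdempotentNoetherian (End E) := by
  intro a ha
  obtain ⟨-, -, ⟨⟨c, hc⟩, ⟨d, hd⟩⟩, hcoh⟩ := E.property
  let H (k : ℤ) := homologyFunctor X.Modules k
  choose n hn using fun k ↦ (hcoh k).exists_comp_eq (fun l ↦ (H k).map (a l).hom)
    fun l l' hl ↦ by
      rw [← Functor.map_comp]
      exact congr((H k).map ($(ha l l' hl)).hom)
  let n₀ := (Finset.Icc c d).sup n
  -- Step `r` consists of the `p` that factor through `τ≤(d - r) E`: everything at `r = 0`, and only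
  -- zero once `d - r < c`.
  refine IsIdempotentNoetherian.exists_of_nilpotent {f | ∀ k, (H k).map f.hom = 0}
    (fun r ↦ {p | p.hom ≫ (t.truncGEπ (d + 1 - r)).app E.obj = 0}) ?_ ?_ (d - c + 1).toNat ?_ a ha
    n₀ ?_
  · intro p
    exact (t.isZero_truncGE_obj_of_isLE d (d + 1 - (0 : ℕ)) (by simp) E.obj).eq_of_tgt _ _
  · intro r u p hu hp
    refine comp_truncGEπ_eq_zero _ p.hom u.hom ?_ (hu _)
    rw [show d + 1 - ((r + 1 : ℕ) : ℤ) + 1 = d + 1 - r by push_cast; ring]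
    exact hp
  · intro p hp
    have : t.IsGE E.obj (d + 1 - ((d - c + 1).toNat : ℤ)) := t.isGE_of_ge _ _ c (by lia)
    have := (t.isGE_iff_isIso_truncGEπ_app _ E.obj).mp this
    rw [Set.mem_ofPred_eq, ← zero_comp, cancel_mono] at hp
    exact ObjectProperty.hom_ext _ hp
  · intro l l' hl hl' k
    by_cases hk : k ∈ Finset.Icc c d
    · have : n k ≤ n₀ := Finset.le_sup hk
      have := hn k l l' (by lia) (by lia)
      have e : (a l' - a l * a l').hom = (a l').hom - (a l').hom ≫ (a l).hom := rfl
      rw [e, Functor.map_sub, Functor.map_comp, this, sub_self]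
    · refine IsZero.eq_of_src ?_ _ _
      simp only [Finset.mem_Icc, not_and_or, not_le] at hk
      obtain hk | hk := hk
      · exact E.obj.isZero_of_isGE c k hk
      · exact E.obj.isZero_of_isLE d k hk
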